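/- Let $\mathbb{K}$ be an imaginary quadratic field, regarded as a subfield of $\mathbb{C}$, let $R$ be its ring of integers, let $\Lambda\subset\mathbb{K}$ be a nonzero fractional ideal, and let $E=\mathbb{C}/\Lambda$. For $x\in E$ write $t_x$ for the translation $p\mapsto x+p$ of $E$. For a holomorphic line bundle $M$ on $E$ with projection $p_M:M\to E$ put $$K(M)=\{x\in E\mid t_x^*M\simeq M\},$$ and let $\mathcal{G}(M)_x$ be the set of automorphisms of $M$ over $x$, that is, of the biholomorphic maps $\phi:M\to M$ that are linear on the fibres and satisfy $p_M\circ\phi=t_x\circ p_M$. For $u,v\in K(M)$ the commutator $\phi\psi\phi^{-1}\psi^{-1}$ of $\phi\in\mathcal{G}(M)_u$ and $\psi\in\mathcal{G}(M)_v$ is the multiplication by a nonzero constant that depends only on $u$ and $v$; this constant is denoted by $e^{M}(u,v)\in\mathbb{C}^*$. **Theorem.** Let $L$ be a holomorphic line bundle on $E$, let $a\in R$, let $a^*L$ be the pull-back of $L$ under the multiplication $a:E\to E$, and let $\tilde a:a^*L\to L$ be the canonical map covering $a$. Let $x,y\in E$ with $ay=x$ and $y\in K(a^*L)$. Then $a^{-1}(x)\subset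 K(a^*L)$, and the following are equivalent: 1. $e^{a^*L}(u,v)=1$ for all $u,v\in a^{-1}(x)$; 2. $x\in K(L)$; 3. for every $\psi\in\mathcal{G}(a^*L)_y$ there exists $\phi\in\mathcal{G}(L)_x$ such that $\tilde a\circ\psi=\phi\circ\tilde a$; 4. there exist $\psi\in\mathcal{G}(a^*L)_y$ and $\phi\in\mathcal{G}(L)_x$ such that $\tilde a\circ\psi=\phi\circ\tilde a$. -/

import Mathlib

open scoped Manifold ContDiff Bundle nonZeroDivisors NumberField
open Bundle

noncomputable section

namespace CMHeisenberg

/-! ### Complex tori `ℂ / Λ` as complex manifolds -/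

section Torus

variable (Λ : AddSubgroup ℂ) [DiscreteTopology Λ]

theorem isLocalHomeomorph_mk : IsLocalHomeomorph (QuotientAddGroup.mk : ℂ → ℂ ⧸ Λ) :=
  (Λ.isAddQuotientCoveringMap_of_comm DiscreteTopology.isDiscrete).isCoveringMap.isLocalHomeomorph

/-- The complex structure of `ℂ / Λ`: the charts are the local inverses of the projection
`ℂ → ℂ / Λ`. -/
instance chartedSpaceTorus : ChartedSpace ℂ (ℂ ⧸ Λ) where
  atlas := {e | ∀ p ∈ e.source, ((e p : ℂ) : ℂ ⧸ Λ) = p}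
  chartAt p := (isLocalHomeomorph_mk Λ).localInverseAt p.out
  mem_chart_source p := by
    have h := (isLocalHomeomorph_mk Λ).apply_self_mem_localInverseAt_source (x := p.out)
    simpa using h
  chart_mem_atlas p := by
    intro q hq
    exact (isLocalHomeomorph_mk Λ).apply_localInverseAt_of_mem hq

variable {Λ}

theorem eventually_eq_add_const {f g : ℂ → ℂ} {w : ℂ} (hf : ContinuousAt f w)
    (hg : ContinuousAt g w) (h : ∀ᶠ z in nhds w, ((f z : ℂ) : ℂ ⧸ Λ) = (g z : ℂ)) :
    ∃ c : ℂ, ∀ᶠ z in nhds w, f z = g z + c := by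
  obtain ⟨U, hU, hU0⟩ : ∃ U ∈ nhds (0 : ℂ), ∀ z ∈ U, z ∈ Λ → z = 0 := by
    have h0 : ({0} : Set Λ) ∈ nhds (0 : Λ) := by simp
    rw [mem_nhds_subtype] at h0
    obtain ⟨U, hU, hs⟩ := h0
    refine ⟨U, hU, fun z hz hz' => ?_⟩
    have : (⟨z, hz'⟩ : Λ) ∈ ({0} : Set Λ) := hs hz
    simpa using this
  refine ⟨f w - g w, ?_⟩
  have hc : ContinuousAt (fun z => (f z - g z) - (f w - g w)) w :=
    (hf.sub hg).sub continuousAt_const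
  have hw := h.self_of_nhds
  rw [QuotientAddGroup.eq_iff_sub_mem] at hw
  have h1 : ∀ᶠ z in nhds w, (f z - g z) - (f w - g w) ∈ U :=
    hc.eventually_mem (by simpa using hU)
  filter_upwards [h, h1] with z hz hz1
  rw [QuotientAddGroup.eq_iff_sub_mem] at hz
  linear_combination hU0 _ hz1 (Λ.sub_mem hz hw)

theorem contDiffOn_of_mk_eq {f g : ℂ → ℂ} {s : Set ℂ} (hs : IsOpen s) (hf : ContinuousOn f s)
    (hg : ContDiff ℂ ω g) (h : ∀ z ∈ s, ((f z : ℂ) : ℂ ⧸ Λ) = (g z : ℂ)) :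
    ContDiffOn ℂ ω f s := by
  intro w hw
  obtain ⟨c, hc⟩ := eventually_eq_add_const (hf.continuousAt (hs.mem_nhds hw))
    hg.continuous.continuousAt (Filter.eventually_of_mem (hs.mem_nhds hw) h)
  exact ((hg.add contDiff_const).contDiffAt.congr_of_eventuallyEq hc).contDiffWithinAt

theorem mk_symm_of_mem_atlas {e : OpenPartialHomeomorph (ℂ ⧸ Λ) ℂ} (he : e ∈ atlas ℂ (ℂ ⧸ Λ))
    {z : ℂ} (hz : z ∈ e.target) : e.symm z = (z : ℂ ⧸ Λ) := by
  have := he _ (e.map_target hz)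
  rw [e.right_inv hz] at this
  exact this.symm

instance isManifoldTorus : IsManifold 𝓘(ℂ) ω (ℂ ⧸ Λ) := by
  apply isManifold_of_contDiffOn
  intro e e' he he'
  have := contDiffOn_of_mk_eq (Λ := Λ) (f := e.symm ≫ₕ e') (g := id) (e.symm ≫ₕ e').open_source
    (e.symm ≫ₕ e').continuousOn contDiff_id (fun z hz => by
      have h1 : z ∈ e.target := by simpa using hz.1
      have h2 : e.symm z ∈ e'.source := by simpa using hz.2
      have := he' _ h2
      simp only [OpenPartialHomeomorph.coe_trans, Function.comp_apply, id]
      rw [this, mk_symm_of_mem_atlas he h1])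
  simpa using this

/-- A map of `ℂ / Λ` that is induced by a holomorphic map of `ℂ` is holomorphic. -/
theorem contMDiff_of_lift {T : ℂ ⧸ Λ → ℂ ⧸ Λ} (hT : Continuous T) {g : ℂ → ℂ}
    (hg : ContDiff ℂ ω g) (h : ∀ z : ℂ, T z = (g z : ℂ)) : ContMDiff 𝓘(ℂ) 𝓘(ℂ) ω T := by
  rw [contMDiff_iff]
  refine ⟨hT, fun x y => ?_⟩
  have hx := chart_mem_atlas ℂ x
  have hy := chart_mem_atlas ℂ y
  set e := chartAt ℂ x
  set e' := chartAt ℂ y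
  have key := contDiffOn_of_mk_eq (Λ := Λ) (f := e' ∘ T ∘ e.symm) (g := g)
    (s := e.target ∩ e.symm ⁻¹' (T ⁻¹' e'.source))
    (e.isOpen_inter_preimage_symm (e'.open_source.preimage hT))
    (e'.continuousOn.comp ((hT.comp_continuousOn e.continuousOn_symm).mono
      Set.inter_subset_left) (fun z hz => hz.2)) hg (fun z hz => by
        rw [← h, Function.comp_apply, Function.comp_apply, hy _ hz.2,
          mk_symm_of_mem_atlas hx hz.1])
  simpa [extChartAt, e, e'] using key

variable (Λ) in
/-- The translation `t_x : p ↦ x + p` of `ℂ / Λ`, as a holomorphic map. -/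
def translation (x : ℂ ⧸ Λ) : C^ω⟮𝓘(ℂ), ℂ ⧸ Λ; 𝓘(ℂ), ℂ ⧸ Λ⟯ :=
  ⟨fun p => x + p, by
    obtain ⟨x, rfl⟩ := QuotientAddGroup.mk_surjective x
    exact contMDiff_of_lift (continuous_const_add _) (g := fun z => x + z)
      (contDiff_const.add contDiff_id) (fun z => rfl)⟩

/-- Multiplication by a complex number `α` with `α Λ ⊆ Λ`, as a holomorphic map of `ℂ / Λ`. -/
def mulMap (α : ℂ) (h : ∀ z ∈ Λ, α * z ∈ Λ) : C^ω⟮𝓘(ℂ), ℂ ⧸ Λ; 𝓘(ℂ), ℂ ⧸ Λ⟯ :=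
  ⟨QuotientAddGroup.map Λ Λ (AddMonoidHom.mulLeft α) h,
    contMDiff_of_lift (g := fun z => α * z)
      (continuous_quot_lift _ (QuotientAddGroup.continuous_mk.comp (continuous_const_mul α)))
      (contDiff_const.mul contDiff_id) (fun _ => rfl)⟩

end Torus


/-! ### Holomorphic line bundles -/

section LineBundle

variable {M : Type*} [TopologicalSpace M] [ChartedSpace ℂ M]
variable {M' : Type*} [TopologicalSpace M'] [ChartedSpace ℂ M']
variable {M'' : Type*} [TopologicalSpace M''] [ChartedSpace ℂ M'']

variable (V : M → Type*) [∀ p, AddCommMonoid (V p)] [∀ p, Module ℂ (V p)]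
  [∀ p, TopologicalSpace (V p)] [TopologicalSpace (TotalSpace ℂ V)] [FiberBundle ℂ V]
variable (W : M' → Type*) [∀ p, AddCommMonoid (W p)] [∀ p, Module ℂ (W p)]
  [∀ p, TopologicalSpace (W p)] [TopologicalSpace (TotalSpace ℂ W)] [FiberBundle ℂ W]
variable (X : M'' → Type*) [∀ p, AddCommMonoid (X p)] [∀ p, Module ℂ (X p)]
  [∀ p, TopologicalSpace (X p)] [TopologicalSpace (TotalSpace ℂ X)] [FiberBundle ℂ X]

/-- `φ` is a biholomorphic map between the total spaces of the line bundles `V` and `W`, which lies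
over the map `t` of the bases and is linear on the fibres. -/
structure IsBundleIso (t : M → M') (φ : TotalSpace ℂ V ≃ TotalSpace ℂ W) : Prop where
  contMDiff : ContMDiff (𝓘(ℂ).prod 𝓘(ℂ)) (𝓘(ℂ).prod 𝓘(ℂ)) ω φ
  contMDiff_symm : ContMDiff (𝓘(ℂ).prod 𝓘(ℂ)) (𝓘(ℂ).prod 𝓘(ℂ)) ω φ.symm
  linear : ∀ p, ∃ f : V p →ₗ[ℂ] W (t p), ∀ v : V p, φ ⟨p, v⟩ = ⟨t p, f v⟩

variable {V W X}

theorem IsBundleIso.trans {t : M → M'} {s : M' → M''} {φ : TotalSpace ℂ V ≃ TotalSpace ℂ W}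
    {ψ : TotalSpace ℂ W ≃ TotalSpace ℂ X} (hφ : IsBundleIso V W t φ) (hψ : IsBundleIso W X s ψ) :
    IsBundleIso V X (s ∘ t) (φ.trans ψ) where
  contMDiff := hψ.contMDiff.comp hφ.contMDiff
  contMDiff_symm := hφ.contMDiff_symm.comp hψ.contMDiff_symm
  linear p := by
    obtain ⟨f, hf⟩ := hφ.linear p
    obtain ⟨g, hg⟩ := hψ.linear (t p)
    exact ⟨g ∘ₗ f, fun v => by simp [hf, hg]⟩

theorem IsBundleIso.symm {t : M → M'} {s : M' → M} {φ : TotalSpace ℂ V ≃ TotalSpace ℂ W}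
    (hφ : IsBundleIso V W t φ) (hst : ∀ p, s (t p) = p) (hts : ∀ p, t (s p) = p) :
    IsBundleIso W V s φ.symm where
  contMDiff := hφ.contMDiff_symm
  contMDiff_symm := hφ.contMDiff
  linear q := by
    obtain ⟨p, rfl⟩ : ∃ p, t p = q := ⟨s q, hts q⟩
    obtain ⟨f, hf⟩ := hφ.linear p
    have hinj : Function.Injective f := fun v w h => by
      have : φ ⟨p, v⟩ = φ ⟨p, w⟩ := by rw [hf, hf, h]
      simpa using φ.injective this
    have hsurj : Function.Surjective f := fun w => by
      obtain ⟨⟨p', v⟩, hv⟩ := φ.surjective ⟨t p, w⟩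
      obtain ⟨f', hf'⟩ := hφ.linear p'
      obtain rfl : p' = p := by
        have := congrArg TotalSpace.proj hv
        rw [hf'] at this
        rw [← hst p', ← hst p]
        exact congrArg s this
      rw [hf] at hv
      exact ⟨v, by simpa using hv⟩
    let e := LinearEquiv.ofBijective f ⟨hinj, hsurj⟩
    have key : ∀ w, φ.symm ⟨t p, w⟩ = ⟨p, e.symm w⟩ := fun w => by
      rw [Equiv.symm_apply_eq, hf]
      congr 1
      exact (e.apply_symm_apply w).symm
    have hp := hst p
    generalize s (t p) = p' at hp
    subst hp
    exact ⟨e.symm.toLinearMap, key⟩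

theorem contMDiff_pullback_lift [VectorBundle ℂ ℂ V] [ContMDiffVectorBundle ω ℂ V 𝓘(ℂ)]
    (g : C^ω⟮𝓘(ℂ), M'; 𝓘(ℂ), M⟯) :
    ContMDiff (𝓘(ℂ).prod 𝓘(ℂ)) (𝓘(ℂ).prod 𝓘(ℂ)) ω
      (Pullback.lift g : TotalSpace ℂ (g *ᵖ V) → TotalSpace ℂ V) := by
  intro z
  have h := (contMDiffAt_totalSpace (F := ℂ) (E := g *ᵖ V) (IB := 𝓘(ℂ)) (n := ω)).1
    (contMDiffAt_id (I := 𝓘(ℂ).prod 𝓘(ℂ)) (x := z))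
  rw [contMDiffAt_totalSpace]
  exact ⟨(g.contMDiff (z.proj)).comp z h.1, h.2⟩

variable (V)

/-- Multiplication by the nonzero constant `c` on the fibres of a line bundle. -/
def scalarAut (c : ℂˣ) : Equiv.Perm (TotalSpace ℂ V) where
  toFun v := ⟨v.proj, c • v.2⟩
  invFun v := ⟨v.proj, c⁻¹ • v.2⟩
  left_inv v := by simp
  right_inv v := by simp

variable {V}

theorem scalarAut_injective [VectorBundle ℂ ℂ V] [Nonempty M] :
    Function.Injective (scalarAut V) := by
  intro c c' h
  obtain ⟨p⟩ := (inferInstance : Nonempty M)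
  let l : V p ≃ₗ[ℂ] ℂ := ((trivializationAt ℂ V p).continuousLinearEquivAt ℂ p
    (FiberBundle.mem_baseSet_trivializationAt' p)).toLinearEquiv
  have h1 : scalarAut V c ⟨p, l.symm 1⟩ = scalarAut V c' ⟨p, l.symm 1⟩ := by rw [h]
  have h2 : (c : ℂ) • l.symm 1 = (c' : ℂ) • l.symm 1 := eq_of_heq (TotalSpace.mk.inj h1).2
  have h3 := congrArg l h2
  rw [l.map_smul, l.map_smul, l.apply_symm_apply] at h3
  exact Units.ext (by simpa using h3)

theorem exists_fibre_scalar [VectorBundle ℂ ℂ V] {φ : TotalSpace ℂ V ≃ TotalSpace ℂ V}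
    (hφ : IsBundleIso V V id φ) (p : M) :
    ∃ c : ℂ, ∀ v : V p, φ ⟨p, v⟩ = ⟨p, c • v⟩ := by
  obtain ⟨f, hf⟩ := hφ.linear p
  let l : V p ≃ₗ[ℂ] ℂ := ((trivializationAt ℂ V p).continuousLinearEquivAt ℂ p
    (FiberBundle.mem_baseSet_trivializationAt' p)).toLinearEquiv
  refine ⟨l (f (l.symm 1)), fun v => ?_⟩
  rw [hf]
  congr 1
  apply l.injective
  have hv : v = l v • l.symm 1 := by
    apply l.injective
    simp
  conv_lhs => rw [hv]
  have : f (l v • l.symm 1) = l v • f (l.symm 1) := f.map_smul _ _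
  rw [this, l.map_smul, l.map_smul, smul_eq_mul, smul_eq_mul, mul_comm]

theorem exists_eq_scalarAut [CompactSpace M] [ConnectedSpace M] [IsManifold 𝓘(ℂ) 1 M]
    [VectorBundle ℂ ℂ V] [ContMDiffVectorBundle ω ℂ V 𝓘(ℂ)]
    {φ : TotalSpace ℂ V ≃ TotalSpace ℂ V} (hφ : IsBundleIso V V id φ) :
    ∃ c : ℂˣ, φ = scalarAut V c := by
  choose c hc using exists_fibre_scalar hφ
  have hol : ContMDiff 𝓘(ℂ) 𝓘(ℂ) ω c := by
    intro p₀
    set e := trivializationAt ℂ V p₀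
    have hp₀ : p₀ ∈ e.baseSet := FiberBundle.mem_baseSet_trivializationAt' p₀
    have h1 : ContMDiffAt 𝓘(ℂ) (𝓘(ℂ).prod 𝓘(ℂ)) ω (fun p : M => (p, (1 : ℂ))) p₀ :=
      contMDiffAt_id.prodMk contMDiffAt_const
    have h2 : ContMDiffAt (𝓘(ℂ).prod 𝓘(ℂ)) (𝓘(ℂ).prod 𝓘(ℂ)) ω
        e.toOpenPartialHomeomorph.symm (p₀, (1 : ℂ)) :=
      (e.contMDiffOn_symm (IB := 𝓘(ℂ)) (n := ω)).contMDiffAt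
        (e.open_target.mem_nhds (by simpa [e.mem_target] using hp₀))
    have h3 := (hφ.contMDiff.contMDiffAt.comp _ h2).comp p₀ h1
    have hs : ∀ p ∈ e.baseSet, e.toOpenPartialHomeomorph.symm (p, (1 : ℂ)) = ⟨p, e.symm p 1⟩ :=
      fun p hp => (e.mk_symm hp 1).symm
    have hmem : φ (e.toOpenPartialHomeomorph.symm (p₀, (1 : ℂ))) ∈ e.source := by
      rw [hs p₀ hp₀, hc, e.mem_source]
      exact hp₀
    have h4 := ((e.contMDiffAt_iff (f := φ ∘ e.toOpenPartialHomeomorph.symm ∘ fun p : M => (p, (1 : ℂ)))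
      hmem).1 h3).2
    refine h4.congr_of_eventuallyEq ?_
    filter_upwards [e.open_baseSet.mem_nhds hp₀] with p hp
    simp only [Function.comp_apply]
    rw [hs p hp, hc]
    have hl := (e.linear ℂ hp).map_smul (c p) (e.symm p 1)
    rw [hl, e.apply_mk_symm hp]
    simp
  obtain ⟨v, hv⟩ := MDifferentiable.exists_eq_const_of_compactSpace
    (hol.mdifferentiable (by simp))
  have hv' : ∀ p, c p = v := fun p => congrFun hv p
  have hv0 : v ≠ 0 := by
    rintro rfl
    obtain ⟨p⟩ := (inferInstance : Nonempty M)
    have hinj : ∀ w w' : V p, w = w' := fun w w' => by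
      have : φ ⟨p, w⟩ = φ ⟨p, w'⟩ := by rw [hc, hc, hv', zero_smul, zero_smul]
      simpa using φ.injective this
    let l : V p ≃ₗ[ℂ] ℂ := ((trivializationAt ℂ V p).continuousLinearEquivAt ℂ p
      (FiberBundle.mem_baseSet_trivializationAt' p)).toLinearEquiv
    exact zero_ne_one (l.symm.injective (hinj (l.symm 0) (l.symm 1)))
  refine ⟨Units.mk0 v hv0, Equiv.ext fun w => ?_⟩
  obtain ⟨p, w⟩ := w
  rw [hc, hv']
  rfl

end LineBundle

/-! ### The Heisenberg group of a line bundle on a complex torus -/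

section Heisenberg

variable {Λ : AddSubgroup ℂ} [DiscreteTopology Λ]
variable (V : ℂ ⧸ Λ → Type*) [∀ p, AddCommMonoid (V p)] [∀ p, Module ℂ (V p)]
  [∀ p, TopologicalSpace (V p)] [TopologicalSpace (TotalSpace ℂ V)] [FiberBundle ℂ V]

/-- `𝒢(L)_x`: the automorphisms of the line bundle `L` over `x`, i.e. the fibrewise linear
biholomorphic maps `φ : L → L` with `p_L ∘ φ = t_x ∘ p_L`. They are regarded as elements of the
group of permutations of the total space of `L`; the group operation is composition. -/
def autOver (x : ℂ ⧸ Λ) : Set (Equiv.Perm (TotalSpace ℂ V)) :=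
  {φ | IsBundleIso V V (translation Λ x) φ}

/-- `K(L) = {x | t_x^* L ≅ L}`, the isomorphism being one of holomorphic line bundles. -/
def translationStabilizer : Set (ℂ ⧸ Λ) :=
  {x | ∃ φ : TotalSpace ℂ (translation Λ x *ᵖ V) ≃ TotalSpace ℂ V,
    IsBundleIso (translation Λ x *ᵖ V) V id φ}

variable {V}

theorem mul_mem_autOver {x y : ℂ ⧸ Λ} {φ ψ : Equiv.Perm (TotalSpace ℂ V)}
    (hφ : φ ∈ autOver V x) (hψ : ψ ∈ autOver V y) : φ * ψ ∈ autOver V (x + y) := by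
  have h := IsBundleIso.trans hψ hφ
  have e : (translation Λ x ∘ translation Λ y) = translation Λ (x + y) :=
    funext fun p => (add_assoc x y p).symm
  rw [e] at h
  exact h

theorem inv_mem_autOver {x : ℂ ⧸ Λ} {φ : Equiv.Perm (TotalSpace ℂ V)}
    (hφ : φ ∈ autOver V x) : φ⁻¹ ∈ autOver V (-x) :=
  IsBundleIso.symm hφ (s := translation Λ (-x)) (fun p => neg_add_cancel_left x p)
    (fun p => add_neg_cancel_left x p)

theorem commutator_mem_autOver {x y : ℂ ⧸ Λ} {φ ψ : Equiv.Perm (TotalSpace ℂ V)}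
    (hφ : φ ∈ autOver V x) (hψ : ψ ∈ autOver V y) : φ * ψ * φ⁻¹ * ψ⁻¹ ∈ autOver V 0 := by
  have h := mul_mem_autOver (mul_mem_autOver (mul_mem_autOver hφ hψ) (inv_mem_autOver hφ))
    (inv_mem_autOver hψ)
  have e : x + y + -x + -y = 0 := by abel
  rw [e] at h
  exact h

theorem mem_autOver_zero_iff {φ : Equiv.Perm (TotalSpace ℂ V)} :
    φ ∈ autOver V 0 ↔ IsBundleIso V V id φ := by
  have e : (translation Λ 0 : ℂ ⧸ Λ → ℂ ⧸ Λ) = id := funext fun p => zero_add p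
  rw [← e]
  rfl

theorem scalarAut_mul_comm {x : ℂ ⧸ Λ} {φ : Equiv.Perm (TotalSpace ℂ V)}
    (hφ : φ ∈ autOver V x) (c : ℂˣ) : scalarAut V c * φ = φ * scalarAut V c := by
  ext1 ⟨p, v⟩
  obtain ⟨f, hf⟩ := hφ.linear p
  have h : f (c • v) = c • f v := f.map_smul (c : ℂ) v
  calc (scalarAut V c * φ) ⟨p, v⟩ = scalarAut V c (φ ⟨p, v⟩) := rfl
    _ = ⟨translation Λ x p, c • f v⟩ := by rw [hf]; rfl
    _ = φ ⟨p, c • v⟩ := by rw [hf, h]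
    _ = (φ * scalarAut V c) ⟨p, v⟩ := rfl

theorem bijective_lift (V : ℂ ⧸ Λ → Type*) (x : ℂ ⧸ Λ) :
    Function.Bijective
      (Pullback.lift (translation Λ x) :
        TotalSpace ℂ (translation Λ x *ᵖ V) → TotalSpace ℂ V) := by
  constructor
  · rintro ⟨p, v⟩ ⟨q, w⟩ h
    have hpq : x + p = x + q := congrArg TotalSpace.proj h
    obtain rfl := add_left_cancel hpq
    have hvw : v = w := eq_of_heq (TotalSpace.mk.inj h).2
    rw [hvw]
  · rintro ⟨q, w⟩
    obtain ⟨p, rfl⟩ : ∃ p, translation Λ x p = q := ⟨-x + q, add_neg_cancel_left x q⟩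
    exact ⟨⟨p, w⟩, rfl⟩

variable [VectorBundle ℂ ℂ V] [ContMDiffVectorBundle ω ℂ V 𝓘(ℂ)]

variable (V) in
theorem isBundleIso_lift (x : ℂ ⧸ Λ) :
    IsBundleIso (translation Λ x *ᵖ V) V (translation Λ x)
      (Equiv.ofBijective _ (bijective_lift V x)) where
  contMDiff := contMDiff_pullback_lift (translation Λ x)
  contMDiff_symm := by
    intro w
    set τ := Equiv.ofBijective _ (bijective_lift V x)
    have hτ : ∀ u, Pullback.lift (translation Λ x) (τ.symm u) = u := τ.apply_symm_apply
    have hp : ∀ u, (τ.symm u).proj = translation Λ (-x) u.proj := fun u => by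
      have h1 : x + (τ.symm u).proj = u.proj := congrArg TotalSpace.proj (hτ u)
      exact eq_neg_add_of_add_eq h1
    rw [contMDiffAt_totalSpace]
    constructor
    · simp only [hp]
      exact ((translation Λ (-x)).contMDiff w.proj).comp w (contMDiffAt_proj V)
    · have h := ((contMDiffAt_totalSpace (F := ℂ) (E := V) (IB := 𝓘(ℂ)) (n := ω)).1
        (contMDiffAt_id (I := 𝓘(ℂ).prod 𝓘(ℂ)) (x := w))).2
      have e1 : (fun u => (trivializationAt ℂ (translation Λ x *ᵖ V) (τ.symm w).proj
          (τ.symm u)).2) = fun u => (trivializationAt ℂ V w.proj u).2 := by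
        funext u
        change (trivializationAt ℂ V (translation Λ x (τ.symm w).proj)
          (Pullback.lift (translation Λ x) (τ.symm u))).2 = _
        rw [hτ, hp]
        have e2 : translation Λ x (translation Λ (-x) w.proj) = w.proj :=
          add_neg_cancel_left x _
        rw [e2]
      rw [e1]
      exact h
  linear p := ⟨LinearMap.id, fun _ => rfl⟩

theorem autOver_nonempty {x : ℂ ⧸ Λ} (hx : x ∈ translationStabilizer V) :
    (autOver V x).Nonempty := by
  obtain ⟨f, hf⟩ := hx
  have h' := (hf.symm (s := id) (fun _ => rfl) (fun _ => rfl)).trans (isBundleIso_lift V x)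
  exact ⟨_, h'⟩

variable [CompactSpace (ℂ ⧸ Λ)]

instance connectedSpaceTorus : ConnectedSpace (ℂ ⧸ Λ) :=
  Quotient.instConnectedSpace

theorem exists_scalar_mul {x : ℂ ⧸ Λ} {φ φ' : Equiv.Perm (TotalSpace ℂ V)}
    (hφ : φ ∈ autOver V x) (hφ' : φ' ∈ autOver V x) : ∃ c : ℂˣ, φ' = scalarAut V c * φ := by
  have h := mul_mem_autOver hφ' (inv_mem_autOver hφ)
  rw [add_neg_cancel, mem_autOver_zero_iff] at h
  have : IsManifold 𝓘(ℂ) 1 (ℂ ⧸ Λ) := IsManifold.of_le (n := ω) (by simp)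
  obtain ⟨c, hc⟩ := exists_eq_scalarAut h
  exact ⟨c, by rw [← hc]; simp⟩

theorem commutator_mul_left {G : Type*} [Group G] {a g h : G} (hg : a * g = g * a)
    (hh : a * h = h * a) : a * g * h * (a * g)⁻¹ * h⁻¹ = g * h * g⁻¹ * h⁻¹ := by
  have hk : Commute a (g * h * g⁻¹ * h⁻¹) :=
    ((Commute.mul_right hg hh).mul_right (Commute.inv_right hg)).mul_right (Commute.inv_right hh)
  have h' : a⁻¹ * h⁻¹ = h⁻¹ * a⁻¹ := (Commute.inv_inv hh).eq
  calc _ = a * g * h * g⁻¹ * (a⁻¹ * h⁻¹) := by group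
    _ = a * (g * h * g⁻¹ * h⁻¹) * a⁻¹ := by rw [h']; group
    _ = _ := by rw [hk.eq]; group

theorem commutator_mul_right {G : Type*} [Group G] {a g h : G} (hg : a * g = g * a)
    (hh : a * h = h * a) : g * (a * h) * g⁻¹ * (a * h)⁻¹ = g * h * g⁻¹ * h⁻¹ := by
  have e := congrArg (·⁻¹) (commutator_mul_left hh hg)
  simp only [mul_inv_rev, inv_inv, ← mul_assoc] at e ⊢
  exact e

/-- The commutator of two automorphisms of `L` over `x` and over `y` is the multiplication by a
nonzero constant, which depends only on `x` and `y`. -/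
theorem existsUnique_commutator (x y : translationStabilizer V) :
    ∃! c : ℂˣ, ∀ φ ∈ autOver V (x : ℂ ⧸ Λ), ∀ ψ ∈ autOver V (y : ℂ ⧸ Λ),
      φ * ψ * φ⁻¹ * ψ⁻¹ = scalarAut V c := by
  obtain ⟨φ₀, hφ₀⟩ := autOver_nonempty x.2
  obtain ⟨ψ₀, hψ₀⟩ := autOver_nonempty y.2
  have : IsManifold 𝓘(ℂ) 1 (ℂ ⧸ Λ) := IsManifold.of_le (n := ω) (by simp)
  obtain ⟨c, hc⟩ := exists_eq_scalarAut (mem_autOver_zero_iff.1 (commutator_mem_autOver hφ₀ hψ₀))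
  refine ⟨c, fun φ hφ ψ hψ => ?_, fun c' hc' => ?_⟩
  · obtain ⟨a, rfl⟩ := exists_scalar_mul hφ₀ hφ
    obtain ⟨b, rfl⟩ := exists_scalar_mul hψ₀ hψ
    rw [commutator_mul_left (scalarAut_mul_comm hφ₀ a) (scalarAut_mul_comm hψ a),
      commutator_mul_right (scalarAut_mul_comm hφ₀ b) (scalarAut_mul_comm hψ₀ b), hc]
  · exact scalarAut_injective (V := V) ((hc' _ hφ₀ _ hψ₀).symm.trans hc)

/-- The commutator pairing `e^L : K(L) × K(L) → ℂˣ`: if `φ` and `ψ` are automorphisms of `L` over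
`x` and `y`, then `φ ψ φ⁻¹ ψ⁻¹` is the multiplication by `e^L(x, y)`. -/
def commutatorPairing (x y : translationStabilizer V) : ℂˣ :=
  (existsUnique_commutator x y).choose

theorem commutatorPairing_spec (x y : translationStabilizer V) :
    ∀ φ ∈ autOver V (x : ℂ ⧸ Λ), ∀ ψ ∈ autOver V (y : ℂ ⧸ Λ),
      φ * ψ * φ⁻¹ * ψ⁻¹ = scalarAut V (commutatorPairing x y) :=
  (existsUnique_commutator x y).choose_spec.1

end Heisenberg

/-! ### Elliptic curves with complex multiplication -/

section CM

variable {K : Type*} [Field K] [NumberField K] (ι : K →+* ℂ)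

/-- The image in `ℂ` of a nonzero fractional ideal `Λ` of `K`, under an embedding `ι : K → ℂ`. -/
def idealLattice (Λ : (FractionalIdeal (𝓞 K)⁰ K)ˣ) : AddSubgroup ℂ :=
  ((Λ : FractionalIdeal (𝓞 K)⁰ K) : Submodule (𝓞 K) K).toAddSubgroup.map ι.toAddMonoidHom

variable {ι}

theorem mem_idealLattice {Λ : (FractionalIdeal (𝓞 K)⁰ K)ˣ} {z : ℂ} :
    z ∈ idealLattice ι Λ ↔ ∃ k ∈ (Λ : FractionalIdeal (𝓞 K)⁰ K), ι k = z := Iff.rfl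

theorem mul_mem_idealLattice (Λ : (FractionalIdeal (𝓞 K)⁰ K)ˣ) (a : 𝓞 K) :
    ∀ z ∈ idealLattice ι Λ, ι a * z ∈ idealLattice ι Λ := by
  rintro _ ⟨k, hk, rfl⟩
  refine ⟨a • k, Submodule.smul_mem _ a hk, ?_⟩
  change ι (a • k) = ι a * ι k
  rw [Algebra.smul_def, map_mul]

theorem exists_ne_zero_mem (Λ : (FractionalIdeal (𝓞 K)⁰ K)ˣ) :
    ∃ k ∈ (Λ : FractionalIdeal (𝓞 K)⁰ K), k ≠ 0 := by
  by_contra! h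
  exact Λ.ne_zero (FractionalIdeal.eq_zero_iff.2 h)

variable [Algebra.IsQuadraticExtension ℚ K] [NumberField.IsTotallyComplex K]

theorem one_le_norm {a : 𝓞 K} (ha : a ≠ 0) : 1 ≤ ‖ι a‖ := by
  have h1 := NumberField.InfinitePlace.card_add_two_mul_card_eq_rank K
  have h2 := NumberField.InfinitePlace.card_eq_nrRealPlaces_add_nrComplexPlaces K
  rw [Algebra.IsQuadraticExtension.finrank_eq_two,
    NumberField.nrRealPlaces_eq_zero_iff.2 inferInstance] at h1
  rw [NumberField.nrRealPlaces_eq_zero_iff.2 inferInstance] at h2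
  have h3 : Fintype.card (NumberField.InfinitePlace K) = 1 := by omega
  have : Subsingleton (NumberField.InfinitePlace K) :=
    Fintype.card_le_one_iff_subsingleton.1 h3.le
  exact NumberField.InfinitePlace.one_le_of_lt_one (w := NumberField.InfinitePlace.mk ι) ha
    (fun z hz => (hz (Subsingleton.elim _ _)).elim)

instance discreteTopology_idealLattice (Λ : (FractionalIdeal (𝓞 K)⁰ K)ˣ) :
    DiscreteTopology (idealLattice ι Λ) := by
  obtain ⟨d, hd, hdΛ⟩ := (Λ : FractionalIdeal (𝓞 K)⁰ K).isFractional
  have hd0 : ι d ≠ 0 := by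
    have := nonZeroDivisors.ne_zero hd
    simpa using this
  apply discreteTopology_of_isOpen_singleton_zero
  rw [Metric.isOpen_singleton_iff]
  refine ⟨‖ι d‖⁻¹, by positivity, ?_⟩
  rintro ⟨_, k, hk, rfl⟩ hlt
  obtain ⟨b, hb⟩ := hdΛ k hk
  have hb' : ι b = ι d * ι k := by
    rw [← map_mul, ← Algebra.smul_def, ← hb]
  have hlt' : ‖ι k‖ < ‖ι d‖⁻¹ := by simpa [dist_eq_norm] using hlt
  have hlt2 : ‖ι b‖ < 1 := by
    rw [hb', norm_mul]
    calc ‖ι d‖ * ‖ι k‖ < ‖ι d‖ * ‖ι d‖⁻¹ := by gcongr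
      _ = 1 := mul_inv_cancel₀ (by simpa using hd0)
  have hb0 : b = 0 := by
    by_contra h
    exact absurd (one_le_norm (ι := ι) h) (not_le.2 hlt2)
  rw [hb0] at hb'
  have hk0 : ι k = 0 := by simpa [hd0] using hb'
  exact Subtype.ext hk0

theorem exists_im_ne_zero : ∃ a : 𝓞 K, (ι a).im ≠ 0 := by
  by_contra! h
  apply NumberField.IsTotallyComplex.complexEmbedding_not_isReal ι
  ext k
  obtain ⟨x, y, -, rfl⟩ := IsFractionRing.div_surjective (A := 𝓞 K) k
  have hx : (starRingEnd ℂ) (ι x) = ι x := Complex.conj_eq_iff_im.2 (h x)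
  have hy : (starRingEnd ℂ) (ι y) = ι y := Complex.conj_eq_iff_im.2 (h y)
  change (starRingEnd ℂ) (ι ((x : K) / (y : K))) = ι ((x : K) / (y : K))
  rw [map_div₀, map_div₀, hx, hy]

instance compactSpace_idealLattice (Λ : (FractionalIdeal (𝓞 K)⁰ K)ˣ) :
    CompactSpace (ℂ ⧸ idealLattice ι Λ) := by
  obtain ⟨k, hk, hk0⟩ := exists_ne_zero_mem Λ
  obtain ⟨a, ha⟩ := exists_im_ne_zero (ι := ι)
  have hι : ι k ≠ 0 := by simpa using hk0
  have hkΛ : ι k ∈ idealLattice ι Λ := ⟨k, hk, rfl⟩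
  have haΛ := mul_mem_idealLattice Λ a _ hkΛ
  let F : ℝ × ℝ → ℂ ⧸ idealLattice ι Λ := fun p =>
    ((p.1 * ι k + p.2 * (ι a * ι k) : ℂ) : ℂ ⧸ idealLattice ι Λ)
  have hF : Continuous F := QuotientAddGroup.continuous_mk.comp (by fun_prop)
  have hc : IsCompact (F '' (Set.Icc 0 1 ×ˢ Set.Icc 0 1)) :=
    (isCompact_Icc.prod isCompact_Icc).image hF
  refine ⟨?_⟩
  convert hc
  symm
  rw [Set.eq_univ_iff_forall]
  intro p
  obtain ⟨z, rfl⟩ := QuotientAddGroup.mk_surjective p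
  set t : ℝ := (z / ι k).im / (ι a).im with ht
  set s : ℝ := (z / ι k).re - t * (ι a).re with hs
  have hz : z = s * ι k + t * (ι a * ι k) := by
    have : z / ι k = s + t * ι a := by
      apply Complex.ext
      · simp [hs]
      · simp [ht, ha]
    field_simp at this
    rw [this]
    ring
  refine ⟨(Int.fract s, Int.fract t), ⟨⟨Int.fract_nonneg _, (Int.fract_lt_one _).le⟩,
    ⟨Int.fract_nonneg _, (Int.fract_lt_one _).le⟩⟩, ?_⟩
  change ((_ : ℂ) : ℂ ⧸ idealLattice ι Λ) = _
  rw [QuotientAddGroup.eq_iff_sub_mem]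
  have e : ((Int.fract s : ℝ) : ℂ) * ι k + ((Int.fract t : ℝ) : ℂ) * (ι a * ι k) - z =
      -(⌊s⌋ • ι k + ⌊t⌋ • (ι a * ι k)) := by
    rw [hz]
    simp only [Int.fract, zsmul_eq_mul]
    push_cast
    ring
  rw [e]
  exact neg_mem (add_mem (zsmul_mem hkΛ _) (zsmul_mem haΛ _))

variable (ι) in
/-- The elliptic curve `E = ℂ / Λ`, for a nonzero fractional ideal `Λ` of `K ⊆ ℂ`. -/
abbrev CMCurve (Λ : (FractionalIdeal (𝓞 K)⁰ K)ˣ) : Type := ℂ ⧸ idealLattice ι Λ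

variable (ι) in
/-- The multiplication by `a ∈ R` on `E = ℂ / Λ`, as a holomorphic map. -/
def cmMul (Λ : (FractionalIdeal (𝓞 K)⁰ K)ˣ) (a : 𝓞 K) :
    C^ω⟮𝓘(ℂ), CMCurve ι Λ; 𝓘(ℂ), CMCurve ι Λ⟯ :=
  mulMap (ι a) (mul_mem_idealLattice Λ a)

end CM

end CMHeisenberg

end

open CMHeisenberg

/-!
Write `ã : a^* L → L` for the canonical map covering `a`. A point of `a^* L` is determined by its
base point and its image under `ã`, and the idea is to pass between automorphisms of `L` over `x`
and automorphisms of `a^* L` over the points of `a⁻¹(x)` along `ã`.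

*Lifting* (`exists_lift_autOver`). If `a u = x`, an automorphism `φ` of `L` over `x` lifts to the
automorphism `(p, v) ↦ (u + p, φ v)` of `a^* L` over `u`. For `φ = 1` these are the canonical
automorphisms over the elements of the kernel of `a`; composing one of them with an automorphism
over `y` gives `a⁻¹(x) ⊆ K(a^* L)`. The lifts of a fixed `φ` to two points `u`, `v` commute with each
other (`lift_mul_comm`), so `e(u, v) = 1` on `a⁻¹(x)` as soon as `x ∈ K(L)`. As the automorphisms
over `y` are unique up to a scalar, each of them is then a scalar multiple of a lift, hence covers
an automorphism of `L`.

*Descent* (`exists_descent_autOver`). Conversely let `a ≠ 0`, let `ψ` be an automorphism of `a^* L`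
over `y`, and let `τ` be one over `k` with `a k = 0`. The commutator of `τ ψ` with `ψ` equals
that of `τ` with `ψ`, and it is trivial if `e(k + y, y) = 1`. Thus `ψ` commutes with the canonical
automorphisms over the kernel. The fibres of `ã` being their orbits, `ψ` descends to a permutation
of `L` over `x`, which is holomorphic because `a` has local holomorphic sections
(`exists_local_section_mulMap`, `contMDiff_of_comp_lift`). If `a = 0`, then `x = 0` lies in `K(L)`
anyway.
-/

namespace CMHeisenberg

/-! ### Holomorphic maps between total spaces -/

section Pullback


theorem pullback_ext {M M' : Type*} {V : M → Type*} {g : M' → M} {z z' : TotalSpace ℂ (g *ᵖ V)}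
    (h₁ : z.proj = z'.proj) (h₂ : Pullback.lift g z = Pullback.lift g z') : z = z' := by
  obtain ⟨p, v⟩ := z
  obtain ⟨p', v'⟩ := z'
  obtain rfl : p = p' := h₁
  have h : v = v' := eq_of_heq (TotalSpace.mk.inj h₂).2
  rw [h]

theorem exists_pullback_point {M M' : Type*} {V : M → Type*} (g : M' → M) (p : M') (w : TotalSpace ℂ V) (h : g p = w.proj) :
    ∃ z : TotalSpace ℂ (g *ᵖ V), z.proj = p ∧ Pullback.lift g z = w := by
  obtain ⟨q, w⟩ := w
  obtain rfl : g p = q := h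
  exact ⟨⟨p, w⟩, rfl, rfl⟩

theorem scalarAut_one {M : Type*} {V : M → Type*} [∀ p, AddCommMonoid (V p)]
    [∀ p, Module ℂ (V p)] : scalarAut V 1 = 1 := by
  ext1 z
  simp [scalarAut]

variable {M : Type*} [TopologicalSpace M] [ChartedSpace ℂ M]
variable {V : M → Type*} [∀ p, AddCommMonoid (V p)]
  [∀ p, TopologicalSpace (V p)] [TopologicalSpace (TotalSpace ℂ V)] [FiberBundle ℂ V]

/-- A map into the total space of a pull-back is holomorphic as soon as its two components, in the
base and in the original bundle, are. -/
theorem contMDiffAt_pullback {M' : Type*} [TopologicalSpace M'] [ChartedSpace ℂ M']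
    {E H N : Type*} [NormedAddCommGroup E] [NormedSpace ℂ E] [TopologicalSpace H]
    {I : ModelWithCorners ℂ E H} [TopologicalSpace N] [ChartedSpace H N]
    (g : C^ω⟮𝓘(ℂ), M'; 𝓘(ℂ), M⟯) {F : N → TotalSpace ℂ (g *ᵖ V)} {n : N}
    (h₁ : ContMDiffAt I 𝓘(ℂ) ω (fun m => (F m).proj) n)
    (h₂ : ContMDiffAt I (𝓘(ℂ).prod 𝓘(ℂ)) ω (fun m => Pullback.lift g (F m)) n) :
    ContMDiffAt I (𝓘(ℂ).prod 𝓘(ℂ)) ω F n := by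
  rw [contMDiffAt_totalSpace] at h₂ ⊢
  exact ⟨h₁, h₂.2⟩

theorem contMDiff_scalarAut [∀ p, Module ℂ (V p)] [VectorBundle ℂ ℂ V]
    [ContMDiffVectorBundle ω ℂ V 𝓘(ℂ)] (c : ℂˣ) :
    ContMDiff (𝓘(ℂ).prod 𝓘(ℂ)) (𝓘(ℂ).prod 𝓘(ℂ)) ω (scalarAut V c) := by
  intro w
  have h := ((contMDiffAt_totalSpace (F := ℂ) (E := V) (IB := 𝓘(ℂ)) (n := ω)).1
    (contMDiffAt_id (I := 𝓘(ℂ).prod 𝓘(ℂ)) (x := w))).2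
  rw [contMDiffAt_totalSpace]
  refine ⟨contMDiffAt_proj V, ?_⟩
  have hs : ContMDiffAt (𝓘(ℂ).prod 𝓘(ℂ)) 𝓘(ℂ) ω
      (fun u => (c : ℂ) • (trivializationAt ℂ V w.proj u).2) w :=
    (contDiff_const_smul (𝕜 := ℂ) (c : ℂ)).contMDiff.contMDiffAt.comp w h
  refine hs.congr_of_eventuallyEq ?_
  set e := trivializationAt ℂ V w.proj
  have hcont : ContinuousAt (TotalSpace.proj : TotalSpace ℂ V → M) w :=
    (FiberBundle.continuous_proj ℂ V).continuousAt
  filter_upwards [hcont.eventually (e.open_baseSet.mem_nhds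
    (FiberBundle.mem_baseSet_trivializationAt' w.proj))] with u hu
  exact (e.linear ℂ hu).map_smul (c : ℂ) u.2

end Pullback

/-! ### Lifting and descending automorphisms along an endomorphism of the torus -/

section Heisenberg

variable {Λ : AddSubgroup ℂ} [DiscreteTopology Λ]
variable {V : ℂ ⧸ Λ → Type*} [∀ p, AddCommMonoid (V p)] [∀ p, Module ℂ (V p)]
  [∀ p, TopologicalSpace (V p)] [TopologicalSpace (TotalSpace ℂ V)] [FiberBundle ℂ V]

theorem proj_apply {x : ℂ ⧸ Λ} {φ : Equiv.Perm (TotalSpace ℂ V)} (hφ : φ ∈ autOver V x)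
    (z : TotalSpace ℂ V) : (φ z).proj = x + z.proj := by
  obtain ⟨p, v⟩ := z
  obtain ⟨f, hf⟩ := hφ.linear p
  rw [hf]
  rfl

theorem one_mem_autOver : (1 : Equiv.Perm (TotalSpace ℂ V)) ∈ autOver V 0 :=
  mem_autOver_zero_iff.2
    ⟨contMDiff_id, contMDiff_id, fun _ => ⟨LinearMap.id, fun _ => rfl⟩⟩

theorem scalarAut_mem_autOver [VectorBundle ℂ ℂ V] [ContMDiffVectorBundle ω ℂ V 𝓘(ℂ)] (c : ℂˣ) :
    scalarAut V c ∈ autOver V 0 :=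
  mem_autOver_zero_iff.2 ⟨contMDiff_scalarAut c, contMDiff_scalarAut c⁻¹,
    fun _ => ⟨(c : ℂ) • LinearMap.id, fun _ => rfl⟩⟩

theorem mem_translationStabilizer [VectorBundle ℂ ℂ V] [ContMDiffVectorBundle ω ℂ V 𝓘(ℂ)]
    {x : ℂ ⧸ Λ} {φ : Equiv.Perm (TotalSpace ℂ V)} (hφ : φ ∈ autOver V x) :
    x ∈ translationStabilizer V := by
  have h := (isBundleIso_lift V x).trans (inv_mem_autOver hφ)
  have e : (translation Λ (-x) ∘ translation Λ x) = id :=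
    funext fun p => neg_add_cancel_left x p
  rw [e] at h
  exact ⟨_, h⟩

variable {g : C^ω⟮𝓘(ℂ), ℂ ⧸ Λ; 𝓘(ℂ), ℂ ⧸ Λ⟯}

theorem contMDiff_of_lift_eq [VectorBundle ℂ ℂ V] [ContMDiffVectorBundle ω ℂ V 𝓘(ℂ)]
    {u : ℂ ⧸ Λ} {φ : TotalSpace ℂ V → TotalSpace ℂ V}
    (hφ : ContMDiff (𝓘(ℂ).prod 𝓘(ℂ)) (𝓘(ℂ).prod 𝓘(ℂ)) ω φ)
    {ψ : TotalSpace ℂ (g *ᵖ V) → TotalSpace ℂ (g *ᵖ V)} (h₁ : ∀ z, (ψ z).proj = u + z.proj)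
    (h₂ : ∀ z, Pullback.lift g (ψ z) = φ (Pullback.lift g z)) :
    ContMDiff (𝓘(ℂ).prod 𝓘(ℂ)) (𝓘(ℂ).prod 𝓘(ℂ)) ω ψ := by
  intro z
  apply contMDiffAt_pullback g
  · simp only [h₁]
    exact ((translation Λ u).contMDiff z.proj).comp z (contMDiffAt_proj _)
  · simp only [h₂]
    exact (hφ.comp (contMDiff_pullback_lift g)) z

/-- An automorphism `φ` of `V` over `g u` lifts to the automorphism
`(p, v) ↦ (u + p, φ v)` of `g^* V` over `u`. -/
theorem exists_lift_autOver [VectorBundle ℂ ℂ V] [ContMDiffVectorBundle ω ℂ V 𝓘(ℂ)]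
    (hg : ∀ p q, g (p + q) = g p + g q) {u : ℂ ⧸ Λ} {φ : Equiv.Perm (TotalSpace ℂ V)}
    (hφ : φ ∈ autOver V (g u)) :
    ∃ ψ ∈ autOver (g *ᵖ V) u, ∀ z, Pullback.lift g (ψ z) = φ (Pullback.lift g z) := by
  have hg0 : g 0 = 0 := by simpa using hg 0 0
  have hgn : g (-u) = -g u := eq_neg_of_add_eq_zero_left (by rw [← hg, neg_add_cancel, hg0])
  choose ψ h₁ h₂ using fun z : TotalSpace ℂ (g *ᵖ V) =>
    exists_pullback_point (V := V) g (u + z.proj) (φ (Pullback.lift g z))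
      (by rw [proj_apply hφ, hg]; rfl)
  choose ψ' h₁' h₂' using fun z : TotalSpace ℂ (g *ᵖ V) =>
    exists_pullback_point (V := V) g (-u + z.proj) (φ⁻¹ (Pullback.lift g z))
      (by rw [proj_apply (inv_mem_autOver hφ), hg, hgn]; rfl)
  let Ψ : Equiv.Perm (TotalSpace ℂ (g *ᵖ V)) :=
    { toFun := ψ
      invFun := ψ'
      left_inv := fun z => pullback_ext (by simp [h₁, h₁']) (by rw [h₂', h₂]; simp)
      right_inv := fun z => pullback_ext (by simp [h₁, h₁']) (by rw [h₂, h₂']; simp) }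
  refine ⟨Ψ, ⟨contMDiff_of_lift_eq hφ.contMDiff h₁ h₂,
    contMDiff_of_lift_eq hφ.contMDiff_symm h₁' h₂', fun p => ?_⟩, h₂⟩
  obtain ⟨f, hf⟩ := hφ.linear (g p)
  obtain ⟨f', hf'⟩ : ∃ f' : V (g p) →ₗ[ℂ] V (g (u + p)),
      ∀ v, φ ⟨g p, v⟩ = ⟨g (u + p), f' v⟩ := by
    have e : g (u + p) = translation Λ (g u) (g p) := hg u p
    rw [e]
    exact ⟨f, hf⟩
  exact ⟨f', fun v => pullback_ext (h₁ _) ((h₂ _).trans (hf' v))⟩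

/-- Lifts of one automorphism of `V` to `g^* V` commute with each other. -/
theorem lift_mul_comm {u v : ℂ ⧸ Λ} {φ : TotalSpace ℂ V → TotalSpace ℂ V}
    {ψ χ : Equiv.Perm (TotalSpace ℂ (g *ᵖ V))}
    (hψ : ψ ∈ autOver (g *ᵖ V) u) (hχ : χ ∈ autOver (g *ᵖ V) v)
    (h₁ : ∀ z, Pullback.lift g (ψ z) = φ (Pullback.lift g z))
    (h₂ : ∀ z, Pullback.lift g (χ z) = φ (Pullback.lift g z)) : ψ * χ = χ * ψ := by
  ext1 z
  apply pullback_ext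
  · simp only [Equiv.Perm.mul_apply, proj_apply hψ, proj_apply hχ]
    abel
  · simp only [Equiv.Perm.mul_apply, h₁, h₂]

/-- If `g` has local holomorphic sections, a map `φ` of `V` which is induced by a holomorphic map
of `g^* V` is itself holomorphic. -/
theorem contMDiff_of_comp_lift [VectorBundle ℂ ℂ V] [ContMDiffVectorBundle ω ℂ V 𝓘(ℂ)]
    (hs : ∀ q, ∃ s : ℂ ⧸ Λ → ℂ ⧸ Λ, ContMDiffAt 𝓘(ℂ) 𝓘(ℂ) ω s q ∧
      ∀ᶠ q' in nhds q, g (s q') = q')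
    {φ : TotalSpace ℂ V → TotalSpace ℂ V} {ψ : TotalSpace ℂ (g *ᵖ V) → TotalSpace ℂ (g *ᵖ V)}
    (hψ : ContMDiff (𝓘(ℂ).prod 𝓘(ℂ)) (𝓘(ℂ).prod 𝓘(ℂ)) ω ψ)
    (h : ∀ z, Pullback.lift g (ψ z) = φ (Pullback.lift g z)) :
    ContMDiff (𝓘(ℂ).prod 𝓘(ℂ)) (𝓘(ℂ).prod 𝓘(ℂ)) ω φ := by
  intro w₀
  obtain ⟨s, hs₁, hs₂⟩ := hs w₀.proj
  have hcont : ContinuousAt (TotalSpace.proj : TotalSpace ℂ V → ℂ ⧸ Λ) w₀ :=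
    (FiberBundle.continuous_proj ℂ V).continuousAt
  have hs₃ : ∀ᶠ w in nhds w₀, g (s w.proj) = w.proj := hcont.eventually hs₂
  -- Away from the domain of the section, the value of `S` is irrelevant.
  have hS : ∀ w : TotalSpace ℂ V, ∃ z : TotalSpace ℂ (g *ᵖ V), g (s w.proj) = w.proj →
      z.proj = s w.proj ∧ Pullback.lift g z = w := fun w => by
    by_cases hw : g (s w.proj) = w.proj
    · obtain ⟨z, hz⟩ := exists_pullback_point g _ w hw
      exact ⟨z, fun _ => hz⟩
    · exact ⟨⟨0, 0⟩, fun h => absurd h hw⟩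
  choose S hS using hS
  have hSm : ContMDiffAt (𝓘(ℂ).prod 𝓘(ℂ)) (𝓘(ℂ).prod 𝓘(ℂ)) ω S w₀ := by
    apply contMDiffAt_pullback g
    · refine (hs₁.comp w₀ (contMDiffAt_proj V)).congr_of_eventuallyEq ?_
      filter_upwards [hs₃] with w hw using (hS w hw).1
    · refine contMDiffAt_id.congr_of_eventuallyEq ?_
      filter_upwards [hs₃] with w hw using (hS w hw).2
  refine (((contMDiff_pullback_lift g).comp hψ).contMDiffAt.comp w₀ hSm).congr_of_eventuallyEq ?_
  filter_upwards [hs₃] with w hw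
  simp only [Function.comp_apply]
  rw [h, (hS w hw).2]

/-- An automorphism of `g^* V` which commutes with the canonical lifts of the translations by the
elements of the kernel of `g` descends to an automorphism of `V`. -/
theorem exists_descent_autOver [VectorBundle ℂ ℂ V] [ContMDiffVectorBundle ω ℂ V 𝓘(ℂ)]
    (hg : ∀ p q, g (p + q) = g p + g q)
    (hs : ∀ q, ∃ s : ℂ ⧸ Λ → ℂ ⧸ Λ, ContMDiffAt 𝓘(ℂ) 𝓘(ℂ) ω s q ∧
      ∀ᶠ q' in nhds q, g (s q') = q')
    {y : ℂ ⧸ Λ} {ψ : Equiv.Perm (TotalSpace ℂ (g *ᵖ V))} (hψ : ψ ∈ autOver (g *ᵖ V) y)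
    (hcomm : ∀ k, g k = 0 → ∀ τ ∈ autOver (g *ᵖ V) k,
      (∀ z, Pullback.lift g (τ z) = Pullback.lift g z) → Commute τ ψ) :
    ∃ φ ∈ autOver V (g y), ∀ z, Pullback.lift g (ψ z) = φ (Pullback.lift g z) := by
  have hsurj : Function.Surjective g := fun q => by
    obtain ⟨s, -, h⟩ := hs q
    exact ⟨s q, h.self_of_nhds⟩
  have hlift : Function.Surjective (Pullback.lift g : TotalSpace ℂ (g *ᵖ V) → TotalSpace ℂ V) :=
    fun w => by
      obtain ⟨p, hp⟩ := hsurj w.proj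
      obtain ⟨z, -, hz⟩ := exists_pullback_point g p w hp
      exact ⟨z, hz⟩
  -- Two points with the same image differ by the lift of a translation in the kernel.
  have key : ∀ χ : Equiv.Perm (TotalSpace ℂ (g *ᵖ V)),
      (∀ k, g k = 0 → ∀ τ ∈ autOver (g *ᵖ V) k,
        (∀ z, Pullback.lift g (τ z) = Pullback.lift g z) → Commute τ χ) →
      ∀ z z', Pullback.lift g z = Pullback.lift g z' →
        Pullback.lift g (χ z) = Pullback.lift g (χ z') := by
    intro χ hχ z z' hz
    have hk : g (z'.proj - z.proj) = 0 := by
      have e : g z.proj = g z'.proj := congrArg TotalSpace.proj hz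
      have := hg (z'.proj - z.proj) z.proj
      rw [sub_add_cancel, ← e] at this
      exact right_eq_add.1 this
    obtain ⟨τ, hτ, hτl⟩ := exists_lift_autOver (u := z'.proj - z.proj) (V := V) hg
      (φ := 1) (by rw [hk]; exact one_mem_autOver)
    have hτl' : ∀ z, Pullback.lift g (τ z) = Pullback.lift g z := hτl
    have hz' : z' = τ z := pullback_ext (by rw [proj_apply hτ]; abel) (by rw [hτl', hz])
    have hc := congrArg (fun σ => σ z) (hχ _ hk τ hτ hτl').eq
    simp only [Equiv.Perm.mul_apply] at hc
    rw [hz', ← hc, hτl']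
  choose σ hσ using hlift
  have h₁ : ∀ z, Pullback.lift g (ψ z) = Pullback.lift g (ψ (σ (Pullback.lift g z))) :=
    fun z => key ψ hcomm _ _ (hσ _).symm
  have h₂ : ∀ z, Pullback.lift g (ψ⁻¹ z) = Pullback.lift g (ψ⁻¹ (σ (Pullback.lift g z))) :=
    fun z => key ψ⁻¹ (fun k hk τ hτ h => (hcomm k hk τ hτ h).inv_right) _ _ (hσ _).symm
  let Φ : Equiv.Perm (TotalSpace ℂ V) :=
    { toFun := fun w => Pullback.lift g (ψ (σ w))
      invFun := fun w => Pullback.lift g (ψ⁻¹ (σ w))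
      left_inv := fun w => by dsimp only; rw [← h₂, Equiv.Perm.inv_def, Equiv.symm_apply_apply, hσ]
      right_inv := fun w => by dsimp only; rw [← h₁, Equiv.Perm.inv_def, Equiv.apply_symm_apply, hσ] }
  refine ⟨Φ, ⟨contMDiff_of_comp_lift hs hψ.contMDiff h₁,
    contMDiff_of_comp_lift hs hψ.contMDiff_symm h₂, fun q => ?_⟩, h₁⟩
  obtain ⟨p, rfl⟩ := hsurj q
  obtain ⟨f, hf⟩ := hψ.linear p
  have hΦ : ∀ v : V (g p), Φ ⟨g p, v⟩ = ⟨g (y + p), f v⟩ := fun v =>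
    (h₁ ⟨p, v⟩).symm.trans (congrArg (Pullback.lift g) (hf v))
  have e : translation Λ (g y) (g p) = g (y + p) := (hg y p).symm
  rw [e]
  exact ⟨f, hΦ⟩

end Heisenberg

/-! ### Local sections of the multiplication maps -/

section Torus

variable {Λ : AddSubgroup ℂ} [DiscreteTopology Λ]

theorem contMDiff_mk : ContMDiff 𝓘(ℂ) 𝓘(ℂ) ω (QuotientAddGroup.mk : ℂ → ℂ ⧸ Λ) := by
  rw [contMDiff_iff]
  refine ⟨QuotientAddGroup.continuous_mk, fun x y => ?_⟩
  have hy := chart_mem_atlas ℂ y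
  set e := chartAt ℂ y
  have key := contDiffOn_of_mk_eq (Λ := Λ) (f := e ∘ QuotientAddGroup.mk) (g := id)
    (s := QuotientAddGroup.mk ⁻¹' e.source)
    (e.open_source.preimage QuotientAddGroup.continuous_mk)
    (e.continuousOn.comp QuotientAddGroup.continuous_mk.continuousOn fun z hz => hz) contDiff_id
    (fun z hz => hy _ hz)
  simpa [extChartAt, e, chartAt_self_eq] using key

/-- If `e` is a chart near `q`, then `p ↦ α⁻¹ * e p` modulo `Λ` is a local section of the
multiplication by `α`. -/
theorem exists_local_section_mulMap {α : ℂ} (hα : α ≠ 0) (h : ∀ z ∈ Λ, α * z ∈ Λ) (q : ℂ ⧸ Λ) :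
    ∃ s : ℂ ⧸ Λ → ℂ ⧸ Λ, ContMDiffAt 𝓘(ℂ) 𝓘(ℂ) ω s q ∧
      ∀ᶠ q' in nhds q, mulMap α h (s q') = q' := by
  have he := chart_mem_atlas ℂ q
  have hq := (chartAt ℂ q).open_source.mem_nhds (mem_chart_source ℂ q)
  refine ⟨fun q' => ((α⁻¹ * chartAt ℂ q q' : ℂ) : ℂ ⧸ Λ), ?_, ?_⟩
  · have h₁ : ContMDiffAt 𝓘(ℂ) 𝓘(ℂ) ω (chartAt ℂ q) q :=
      (contMDiffOn_chart (I := 𝓘(ℂ)) (n := ω)).contMDiffAt hq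
    have h₂ : ContMDiff 𝓘(ℂ) 𝓘(ℂ) ω (fun z : ℂ => α⁻¹ * z) :=
      (contDiff_const.mul contDiff_id).contMDiff
    exact ((contMDiff_mk (Λ := Λ)).comp h₂).contMDiffAt.comp q h₁
  · filter_upwards [hq] with q' hq'
    have e : mulMap α h ((α⁻¹ * chartAt ℂ q q' : ℂ) : ℂ ⧸ Λ) =
        ((α * (α⁻¹ * chartAt ℂ q q') : ℂ) : ℂ ⧸ Λ) := rfl
    rw [e, mul_inv_cancel_left₀ hα]
    exact he q' hq'

theorem mulMap_add (α : ℂ) (h : ∀ z ∈ Λ, α * z ∈ Λ) (p q : ℂ ⧸ Λ) :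
    mulMap α h (p + q) = mulMap α h p + mulMap α h q :=
  map_add (QuotientAddGroup.map Λ Λ (AddMonoidHom.mulLeft α) h) p q

theorem mulMap_eq_zero {α : ℂ} (h : ∀ z ∈ Λ, α * z ∈ Λ) (hα : α = 0) (p : ℂ ⧸ Λ) :
    mulMap α h p = 0 := by
  subst hα
  obtain ⟨z, rfl⟩ := QuotientAddGroup.mk_surjective p
  exact congrArg QuotientAddGroup.mk (zero_mul z)

end Torus

end CMHeisenberg

/-! ### The commutator pairing on the fibres of the multiplication by `a` -/

theorem mainTheorem12 {K : Type*} [Field K] [NumberField K] [Algebra.IsQuadraticExtension ℚ K]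
    [NumberField.IsTotallyComplex K] (ι : K →+* ℂ) (Λ : (FractionalIdeal (𝓞 K)⁰ K)ˣ)
    (L : CMCurve ι Λ → Type*) [∀ p, AddCommMonoid (L p)] [∀ p, Module ℂ (L p)]
    [∀ p, TopologicalSpace (L p)] [TopologicalSpace (TotalSpace ℂ L)] [FiberBundle ℂ L]
    [VectorBundle ℂ ℂ L] [ContMDiffVectorBundle ω ℂ L 𝓘(ℂ)]
    (a : 𝓞 K) (x y : CMCurve ι Λ) (hxy : cmMul ι Λ a y = x)
    (hy : y ∈ translationStabilizer (cmMul ι Λ a *ᵖ L)) :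
    ∃ hA : ∀ u, cmMul ι Λ a u = x → u ∈ translationStabilizer (cmMul ι Λ a *ᵖ L),
      List.TFAE [
        ∀ u v (hu : cmMul ι Λ a u = x) (hv : cmMul ι Λ a v = x),
          commutatorPairing (V := cmMul ι Λ a *ᵖ L) ⟨u, hA u hu⟩ ⟨v, hA v hv⟩ = 1,
        x ∈ translationStabilizer L,
        ∀ ψ ∈ autOver (cmMul ι Λ a *ᵖ L) y, ∃ φ ∈ autOver L x,
          Pullback.lift (cmMul ι Λ a) ∘ ψ = φ ∘ Pullback.lift (cmMul ι Λ a),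
        ∃ ψ ∈ autOver (cmMul ι Λ a *ᵖ L) y, ∃ φ ∈ autOver L x,
          Pullback.lift (cmMul ι Λ a) ∘ ψ = φ ∘ Pullback.lift (cmMul ι Λ a)] := by
  have hg : ∀ p q, cmMul ι Λ a (p + q) = cmMul ι Λ a p + cmMul ι Λ a q := mulMap_add _ _
  have hA : ∀ u, cmMul ι Λ a u = x → u ∈ translationStabilizer (cmMul ι Λ a *ᵖ L) := by
    intro u hu
    have hk : cmMul ι Λ a (u - y) = 0 := by
      have := hg (u - y) y
      rw [sub_add_cancel, hu, hxy] at this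
      exact right_eq_add.1 this
    obtain ⟨τ, hτ, -⟩ := exists_lift_autOver (V := L) (u := u - y) hg (φ := 1)
      (by rw [hk]; exact one_mem_autOver)
    obtain ⟨ψ, hψ⟩ := autOver_nonempty hy
    have := mem_translationStabilizer (mul_mem_autOver hτ hψ)
    rwa [sub_add_cancel] at this
  refine ⟨hA, ?_⟩
  tfae_have 1 → 2 := by
    intro h
    by_cases ha : ι a = 0
    · have hx : x = 0 := hxy.symm.trans (mulMap_eq_zero _ ha y)
      rw [hx]
      exact mem_translationStabilizer one_mem_autOver
    · obtain ⟨ψ, hψ⟩ := autOver_nonempty hy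
      have hcomm : ∀ k, cmMul ι Λ a k = 0 → ∀ τ ∈ autOver (cmMul ι Λ a *ᵖ L) k,
          Commute τ ψ := by
        intro k hk τ hτ
        have hky : cmMul ι Λ a (k + y) = x := by rw [hg, hk, hxy, zero_add]
        have hc := commutatorPairing_spec ⟨k + y, hA _ hky⟩ ⟨y, hy⟩ _
          (mul_mem_autOver hτ hψ) ψ hψ
        rw [h _ _ hky hxy, scalarAut_one] at hc
        -- The commutators of `τ * ψ` and of `τ` with `ψ` coincide.
        have hc' : τ * ψ * τ⁻¹ * ψ⁻¹ = 1 := by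
          rw [← hc]
          group
        rwa [mul_inv_eq_one, mul_inv_eq_iff_eq_mul] at hc'
      obtain ⟨φ, hφ, -⟩ := exists_descent_autOver (V := L) hg
        (exists_local_section_mulMap ha _) hψ fun k hk τ hτ _ => hcomm k hk τ hτ
      rw [← hxy]
      exact mem_translationStabilizer hφ
  tfae_have 2 → 1 := by
    intro h u v hu hv
    obtain ⟨φ, hφ⟩ := autOver_nonempty h
    obtain ⟨ψ, hψ, hψl⟩ := exists_lift_autOver (V := L) (u := u) hg (by rw [hu]; exact hφ)
    obtain ⟨χ, hχ, hχl⟩ := exists_lift_autOver (V := L) (u := v) hg (by rw [hv]; exact hφ)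
    have hc := commutatorPairing_spec ⟨u, hA u hu⟩ ⟨v, hA v hv⟩ ψ hψ χ hχ
    rw [lift_mul_comm hψ hχ hψl hχl, mul_inv_cancel_right, mul_inv_cancel] at hc
    apply scalarAut_injective (V := cmMul ι Λ a *ᵖ L)
    rw [← hc, scalarAut_one]
  tfae_have 2 → 3 := by
    intro h ψ hψ
    obtain ⟨φ, hφ⟩ := autOver_nonempty h
    obtain ⟨ψ', hψ', hl⟩ := exists_lift_autOver (V := L) (u := y) hg (by rw [hxy]; exact hφ)
    obtain ⟨c, rfl⟩ := exists_scalar_mul hψ' hψ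
    refine ⟨scalarAut L c * φ, ?_, funext fun z => congrArg (scalarAut L c) (hl z)⟩
    have := mul_mem_autOver (scalarAut_mem_autOver (V := L) c) hφ
    rwa [zero_add] at this
  tfae_have 3 → 4 := by
    intro h
    obtain ⟨ψ, hψ⟩ := autOver_nonempty hy
    exact ⟨ψ, hψ, h ψ hψ⟩
  tfae_have 4 → 2 := by
    rintro ⟨-, -, φ, hφ, -⟩
    exact mem_translationStabilizer hφ
  tfae_finish
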